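/- For $d\ge 1$ and a sequence $\mathbf s=(s_1,\dots,s_d)$ of positive integers let $$\mathbf P_d^{(\mathbf s)}=\Big\{x\in\mathbb R^d : 0\le \frac{x_1}{s_1}\le \frac{x_2}{s_2}\le\cdots\le\frac{x_d}{s_d}\le 1\Big\}$$ be the $\mathbf s$-lecture hall polytope. A lattice polytope $\mathcal P\subset\mathbb R^d$ (the convex hull of finitely many points of $\mathbb Z^d$) is called *reflexive* if its only interior lattice point is the origin and its dual $\{y\in\mathbb R^d:\langle x,y\rangle\le 1\text{ for all }x\in \mathcal P\}$ is again a lattice polytope. For an integer $c\ge 1$, a lattice polytope $\mathcal P\subset\mathbb R^d$ is called *Gorenstein of index $c$* if $c\mathcal P$ is unimodularly equivalent to a reflexive polytope, i.e. if there are $U\in\mathbb Z^{d\times d}$ with $\det U=\pm1$ and $w\in\mathbb Z^d$ such that $\{vU+w: v\in c\mathcal P\}$ is reflexive. **Theorem.** Let $d,e\ge 1$, and let $\mathbf s=(s_1,\dots,s_d)$ and $\mathbf t=(t_1,\dots,t_e)$ be sequences of positive integers such that $\mathbf P_d^{(\mathbf s)}$ is Gorenstein of index $k$ and $\mathbf P_e^{(\mathbf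 t)}$ is Gorenstein of index $\ell$. Then the lecture hall polytope $\mathbf P_{d+e+1}^{(\mathbf s,1,\mathbf t)}$ of the concatenated sequence $(s_1,\dots,s_d,1,t_1,\dots,t_e)$ is Gorenstein of index $k+\ell$. -/

import Mathlib

namespace LectureHall

/-- The embedding of `ℤ^d` into `ℝ^d`. -/
def latticePoint {d : ℕ} (v : Fin d → ℤ) : Fin d → ℝ := fun i => (v i : ℝ)

/-- A lattice polytope in `ℝ^d`: the convex hull of finitely many points of `ℤ^d`. -/
def IsLatticePolytope {d : ℕ} (P : Set (Fin d → ℝ)) : Prop :=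
  ∃ V : Finset (Fin d → ℤ), P = convexHull ℝ (latticePoint '' (V : Set (Fin d → ℤ)))

/-- `Q = f_U(P) + w` for a unimodular integer matrix `U` and an integer vector `w`, where
`f_U(v) = v U` (row vectors). -/
def UnimodularlyEquivalent {d : ℕ} (P Q : Set (Fin d → ℝ)) : Prop :=
  ∃ (U : Matrix (Fin d) (Fin d) ℤ) (w : Fin d → ℤ),
    (U.det = 1 ∨ U.det = -1) ∧
      Q = (fun v => Matrix.vecMul v (U.map (Int.cast : ℤ → ℝ)) + latticePoint w) '' P

/-- A Fano polytope: a lattice polytope in `ℝ^d` whose only interior lattice point is the origin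
(in particular it is `d`-dimensional). Here `interior P` is `P` minus its boundary. -/
def IsFano {d : ℕ} (P : Set (Fin d → ℝ)) : Prop :=
  IsLatticePolytope P ∧ interior P ∩ Set.range (latticePoint (d := d)) = {0}

/-- The dual (polar) of `P`. -/
def dualPolytope {d : ℕ} (P : Set (Fin d → ℝ)) : Set (Fin d → ℝ) :=
  {y | ∀ x ∈ P, dotProduct x y ≤ 1}

/-- A reflexive polytope: a Fano polytope whose dual is a lattice polytope. -/
def IsReflexive {d : ℕ} (P : Set (Fin d → ℝ)) : Prop :=
  IsFano P ∧ IsLatticePolytope (dualPolytope P)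

/-- The dilate `c P = {c x : x ∈ P}`. -/
def dilate {d : ℕ} (c : ℕ) (P : Set (Fin d → ℝ)) : Set (Fin d → ℝ) :=
  (fun x => (c : ℝ) • x) '' P

/-- A lattice polytope `P` is Gorenstein of index `c ≥ 1` if `c P` is unimodularly equivalent to a
reflexive polytope. (This forces `P` to be `d`-dimensional.) -/
def IsGorenstein {d : ℕ} (c : ℕ) (P : Set (Fin d → ℝ)) : Prop :=
  IsLatticePolytope P ∧ 0 < c ∧
    ∃ Q : Set (Fin d → ℝ), IsReflexive Q ∧ UnimodularlyEquivalent (dilate c P) Q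

/-- The lecture hall polytope
`{x ∈ ℝ^d : 0 ≤ x₁ / s₁ ≤ x₂ / s₂ ≤ ⋯ ≤ x_d / s_d ≤ 1}` of a sequence `s` of positive integers. -/
def lectureHallPolytope {d : ℕ} (s : Fin d → ℕ) : Set (Fin d → ℝ) :=
  {x | (∀ i, 0 ≤ x i / (s i : ℝ)) ∧ Monotone (fun i => x i / (s i : ℝ)) ∧
    ∀ i, x i / (s i : ℝ) ≤ 1}

/-- The sequence `(s, 1, t) = (s₁, …, s_d, 1, t₁, …, t_e)` of length `d + e + 1`. -/
def concatOne {d e : ℕ} (s : Fin d → ℕ) (t : Fin e → ℕ) : Fin (d + e + 1) → ℕ :=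
  (Fin.append s (Fin.cons 1 t : Fin (e + 1) → ℕ) : Fin (d + (e + 1)) → ℕ)

end LectureHall

/-!
A lattice simplex with primitive integral facet normals is Gorenstein of index `c` exactly when its
`c`-fold dilate contains an integer point at height one above every facet
(`LatticeSimplex.isGorenstein_iff`). The dual of the dilate, translated by an interior point `a`, has
as vertices the negated facet normals divided by the heights of `a`. If the dual is a lattice
polytope these vertices are integral, and primitivity forces the heights to be one. Conversely, if
all heights are one, the dual is the convex hull of the negated normals, and an interior lattice
point of the translated dilate has nonnegative inner product with each normal. Some positive
combination of the normals vanishes, so these products are all zero and the point is the origin.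

The lecture hall polytope is such a simplex. With `S = (1, s₁, …, s_d, 1)`, numbered from `0`, and a
point extended to `X = (0, x₁, …, x_d, c)`, its facet heights in the `c`-fold dilate are
`(S_i X_{i+1} - S_{i+1} X_i) / gcd(S_i, S_{i+1})`. So the Gorenstein property is the existence of an
integer sequence `A` from `0` to `c` with `S_i A_{i+1} - S_{i+1} A_i = gcd(S_i, S_{i+1})` for all `i`
(`isGorenstein_lectureHallPolytope_iff`).

Given such sequences `A` for `(s, k)` and `B` for `(t, l)`, follow `A` up to its last term `k` and
continue with `B + k T`, where `T` is the padded sequence of `t`. The two parts agree at the entry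
`1` between `s` and `t`, adding a multiple of `T` does not change the cross differences, and the last
term is `k + l`.
-/

namespace LectureHall

open Matrix

/-! ### Lattice points and affine functions -/

theorem latticePoint_dotProduct {d : ℕ} (v w : Fin d → ℤ) :
    latticePoint v ⬝ᵥ latticePoint w = ((v ⬝ᵥ w : ℤ) : ℝ) := by
  simp [latticePoint, dotProduct]

theorem latticePoint_neg {d : ℕ} (v : Fin d → ℤ) :
    latticePoint (-v) = -latticePoint v := by
  ext i; simp [latticePoint]

theorem latticePoint_zero {d : ℕ} : latticePoint (0 : Fin d → ℤ) = 0 := by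
  ext i; simp [latticePoint]

theorem latticePoint_vecMul {d : ℕ} (v : Fin d → ℤ) (U : Matrix (Fin d) (Fin d) ℤ) :
    latticePoint (v ᵥ* U) = latticePoint v ᵥ* U.map (Int.cast : ℤ → ℝ) := by
  ext i; simp [latticePoint, vecMul, dotProduct]

theorem latticePoint_mulVec {d : ℕ} (U : Matrix (Fin d) (Fin d) ℤ) (v : Fin d → ℤ) :
    latticePoint (U *ᵥ v) = U.map (Int.cast : ℤ → ℝ) *ᵥ latticePoint v := by
  ext i; simp [latticePoint, mulVec, dotProduct]

theorem isLatticePolytope_of_image {d : ℕ} {P : Set (Fin d → ℝ)} {ι : Type} [Fintype ι]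
    (u : ι → Fin d → ℤ) (h : P = convexHull ℝ (Set.range fun i => latticePoint (u i))) :
    IsLatticePolytope P := by
  classical
  refine ⟨Finset.univ.image u, ?_⟩
  rw [h, Finset.coe_image, Finset.coe_univ, Set.image_univ, ← Set.range_comp]
  rfl

/-- An affine function that is nonnegative on a set and not constant is positive on its interior. -/
theorem pos_of_mem_interior {d : ℕ} {Q : Set (Fin d → ℝ)} {r : Fin d → ℝ} {β : ℝ} (hr : r ≠ 0)
    (hQ : ∀ y ∈ Q, 0 ≤ r ⬝ᵥ y + β) {y : Fin d → ℝ} (hy : y ∈ interior Q) :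
    0 < r ⬝ᵥ y + β := by
  have hcont : Continuous fun ε : ℝ => y - ε • r := by fun_prop
  have hmem : (fun ε : ℝ => y - ε • r) ⁻¹' interior Q ∈ nhdsWithin (0 : ℝ) (Set.Ioi 0) :=
    mem_nhdsWithin_of_mem_nhds <|
      (isOpen_interior.preimage hcont).mem_nhds (by simpa using hy)
  obtain ⟨ε, hε, hε0⟩ :=
    (Filter.inter_mem hmem self_mem_nhdsWithin : _ ∩ Set.Ioi (0 : ℝ) ∈ _) |>
      Filter.nonempty_of_mem
  have h := hQ _ (interior_subset hε)
  have hrr : 0 < r ⬝ᵥ r :=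
    lt_of_le_of_ne (by simpa [dotProduct] using Finset.sum_nonneg fun i _ => mul_self_nonneg (r i))
      (Ne.symm (mt dotProduct_self_eq_zero.1 hr))
  rw [dotProduct_sub, dotProduct_smul, smul_eq_mul] at h
  have := mul_pos (Set.mem_Ioi.1 hε0) hrr
  linarith

/-! ### Lattice simplices and their facet heights -/

/-- A full-dimensional lattice simplex in `ℝ^d`, given by its vertices and its facet inequalities
`⟨normal i, x⟩ + const i ≥ 0` with primitive integral inner normals. The `i`-th facet is opposite to
the `i`-th vertex, whose height above it is `width i`. The fields `sum_height` and
`sum_height_smul_vertex` say that the normalized heights are the barycentric coordinates, in a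
homogeneous form that serves every dilate: `c` is the dilation factor. -/
structure LatticeSimplex (d : ℕ) (ι : Type) [Fintype ι] [DecidableEq ι] where
  vertex : ι → Fin d → ℤ
  normal : ι → Fin d → ℤ
  const : ι → ℤ
  width : ι → ℤ
  width_pos : ∀ i, 0 < width i
  height_vertex : ∀ i j, normal i ⬝ᵥ vertex j + const i = if i = j then width i else 0
  sum_height : ∀ (c : ℝ) (x : Fin d → ℝ),
    ∑ i, (latticePoint (normal i) ⬝ᵥ x + c * const i) / width i = c
  sum_height_smul_vertex : ∀ (c : ℝ) (x : Fin d → ℝ),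
    ∑ i, ((latticePoint (normal i) ⬝ᵥ x + c * const i) / width i) • latticePoint (vertex i) = x
  primitive : ∀ i (m : ℤ), (∀ j, m ∣ normal i j) → IsUnit m

namespace LatticeSimplex

variable {d : ℕ} {ι : Type} [Fintype ι] [DecidableEq ι] (T : LatticeSimplex d ι)

/-- The affine function that defines the `i`-th facet of the `c`-fold dilate. -/
def height (c : ℝ) (i : ι) (x : Fin d → ℝ) : ℝ := latticePoint (T.normal i) ⬝ᵥ x + c * T.const i

/-- The simplex, as the intersection of its facet half-spaces. -/
def carrier : Set (Fin d → ℝ) := {x | ∀ i, 0 ≤ T.height 1 i x}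

theorem width_pos_real (i : ι) : (0 : ℝ) < T.width i := Int.cast_pos.2 (T.width_pos i)

theorem height_smul (c : ℝ) (i : ι) (x : Fin d → ℝ) :
    T.height c i (c • x) = c * T.height 1 i x := by
  simp only [height, dotProduct_smul, smul_eq_mul]; ring

theorem height_one_vertex (i j : ι) :
    T.height 1 i (latticePoint (T.vertex j)) = if i = j then (T.width i : ℝ) else 0 := by
  have h := congrArg (Int.cast : ℤ → ℝ) (T.height_vertex i j)
  push_cast at h
  rw [height, latticePoint_dotProduct, one_mul, h]

theorem height_smul_vertex_nonneg {c : ℝ} (hc : 0 ≤ c) (i j : ι) :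
    0 ≤ T.height c i (c • latticePoint (T.vertex j)) := by
  rw [height_smul, height_one_vertex]
  split_ifs
  · exact mul_nonneg hc (T.width_pos_real i).le
  · simp

theorem dilate_carrier {c : ℕ} (hc : 0 < c) :
    dilate c T.carrier = {x | ∀ i, 0 ≤ T.height c i x} := by
  have hc' : (0 : ℝ) < c := Nat.cast_pos.2 hc
  ext x
  constructor
  · rintro ⟨y, hy, rfl⟩ i
    change 0 ≤ T.height c i ((c : ℝ) • y)
    rw [height_smul]
    exact mul_nonneg hc'.le (hy i)
  · intro hx
    refine ⟨(c : ℝ)⁻¹ • x, fun i => ?_, smul_inv_smul₀ hc'.ne' x⟩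
    have h := hx i
    rw [← smul_inv_smul₀ hc'.ne' x, height_smul] at h
    exact nonneg_of_mul_nonneg_right h hc'

theorem convex_setOf_height_nonneg (c : ℝ) : Convex ℝ {x | ∀ i, 0 ≤ T.height c i x} := by
  intro x hx y hy α β hα hβ hαβ i
  have : T.height c i (α • x + β • y) = α * T.height c i x + β * T.height c i y := by
    simp only [height, dotProduct_add, dotProduct_smul, smul_eq_mul]
    linear_combination (-(c * (T.const i : ℝ))) * hαβ
  rw [this]
  exact add_nonneg (mul_nonneg hα (hx i)) (mul_nonneg hβ (hy i))

theorem setOf_height_nonneg_eq_convexHull {c : ℝ} (hc : 0 < c) :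
    {x | ∀ i, 0 ≤ T.height c i x} =
      convexHull ℝ (Set.range fun i => c • latticePoint (T.vertex i)) := by
  apply Set.Subset.antisymm
  · intro x hx
    have hsum : ∑ i, T.height c i x / T.width i / c = 1 := by
      rw [← Finset.sum_div]
      exact (congrArg (· / c) (T.sum_height c x)).trans (div_self hc.ne')
    have hx' : ∑ i, (T.height c i x / T.width i / c) • c • latticePoint (T.vertex i) = x := by
      simp only [smul_smul, div_mul_cancel₀ _ hc.ne']
      exact T.sum_height_smul_vertex c x
    rw [← hx']
    exact (convex_convexHull ℝ _).sum_mem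
      (fun i _ => div_nonneg (div_nonneg (hx i) (T.width_pos_real i).le) hc.le) hsum
      (fun i _ => subset_convexHull ℝ _ ⟨i, rfl⟩)
  · refine convexHull_min ?_ (T.convex_setOf_height_nonneg c)
    rintro _ ⟨j, rfl⟩ i
    exact T.height_smul_vertex_nonneg hc.le i j

theorem isLatticePolytope_carrier : IsLatticePolytope T.carrier :=
  isLatticePolytope_of_image T.vertex <| by
    simpa [carrier] using T.setOf_height_nonneg_eq_convexHull one_pos

/-- An affine function is the combination of the facet heights whose coefficients are its normalized
values at the vertices of the dilated simplex. -/
theorem affine_eq_sum_height {c : ℝ} (hc : c ≠ 0) (γ : ℝ) (r x : Fin d → ℝ) :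
    γ + r ⬝ᵥ x = ∑ j, (γ + r ⬝ᵥ (c • latticePoint (T.vertex j))) / (c * T.width j) *
      T.height c j x := by
  have h1 := T.sum_height c x
  have h2 := congrArg (r ⬝ᵥ ·) (T.sum_height_smul_vertex c x)
  simp only [dotProduct_sum, dotProduct_smul, smul_eq_mul] at h2
  calc γ + r ⬝ᵥ x = γ / c * c + r ⬝ᵥ x := by rw [div_mul_cancel₀ _ hc]
    _ = _ := by
      nth_rewrite 2 [← h1]
      rw [← h2, Finset.mul_sum, ← Finset.sum_add_distrib]
      refine Finset.sum_congr rfl fun j _ => ?_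
      have := (T.width_pos_real j).ne'
      simp only [dotProduct_smul, smul_eq_mul, height]
      field_simp

/-- The linear part of the expansion of an affine function in the heights. -/
theorem linear_eq_sum_normal {c : ℝ} (hc : c ≠ 0) (γ : ℝ) (r : Fin d → ℝ) (m : Fin d) :
    r m = ∑ j, (γ + r ⬝ᵥ (c • latticePoint (T.vertex j))) / (c * T.width j) * T.normal j m := by
  have h0 := T.affine_eq_sum_height hc γ r 0
  have h1 := T.affine_eq_sum_height hc γ r (Pi.single m 1)
  rw [dotProduct_zero, add_zero] at h0
  rw [dotProduct_single, mul_one] at h1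
  have h : r m = (γ + r m) - γ := by ring
  rw [h, h1]
  nth_rewrite 2 [h0]
  rw [← Finset.sum_sub_distrib]
  refine Finset.sum_congr rfl fun j _ => ?_
  simp only [height, dotProduct_zero, dotProduct_single, latticePoint]
  ring

theorem normal_ne_zero (i : ι) : T.normal i ≠ 0 := by
  intro h
  have := T.primitive i 2 (by simp [h])
  exact absurd this (by decide)

theorem height_add (c : ℝ) (i : ι) (x y : Fin d → ℝ) :
    T.height c i (x + y) = T.height c i x + latticePoint (T.normal i) ⬝ᵥ y := by
  simp only [height, dotProduct_add]; ring

theorem height_latticePoint (c : ℕ) (i : ι) (a : Fin d → ℤ) :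
    T.height c i (latticePoint a) = ((T.normal i ⬝ᵥ a + c * T.const i : ℤ) : ℝ) := by
  simp [height, latticePoint_dotProduct]

/-! ### The Gorenstein criterion for lattice simplices -/

/-- The point that a unimodular equivalence carries to the origin of a reflexive polytope has
height one above every facet: the dual is a lattice polytope, so its vertices are integral, and
primitivity of the facet normals leaves no other positive height. -/
theorem exists_height_eq_one_of_isGorenstein {c : ℕ} (h : IsGorenstein c T.carrier) :
    ∃ a : Fin d → ℤ, ∀ i, T.normal i ⬝ᵥ a + c * T.const i = 1 := by
  obtain ⟨-, hc, Q, ⟨⟨-, hint⟩, V, hV⟩, U, w, hU, hQ⟩ := h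
  have hc' : (0 : ℝ) < c := Nat.cast_pos.2 hc
  have hdet : IsUnit U.det := Int.isUnit_iff.2 hU
  set UR := U.map (Int.cast : ℤ → ℝ) with hUR
  set WR := (U⁻¹).map (Int.cast : ℤ → ℝ) with hWR
  have hUW : UR * WR = 1 := by
    have := congrArg (Int.castRingHom ℝ).mapMatrix (mul_nonsing_inv U hdet)
    rwa [map_mul, map_one] at this
  have hWU : WR * UR = 1 := mul_eq_one_comm.1 hUW
  -- `a` is the point of the dilate that the equivalence carries to the origin.
  set a : Fin d → ℤ := (-w) ᵥ* U⁻¹ with ha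
  set A : Fin d → ℝ := latticePoint a with hA
  have hAU : A ᵥ* UR = -latticePoint w := by
    rw [hA, ha, latticePoint_vecMul, vecMul_vecMul, hWU, vecMul_one, latticePoint_neg]
  have hφ : ∀ x : Fin d → ℝ, x ᵥ* UR + latticePoint w = (x - A) ᵥ* UR := fun x => by
    rw [sub_vecMul, hAU, sub_neg_eq_add]
  rw [T.dilate_carrier hc] at hQ
  have hmem : ∀ x, (∀ i, 0 ≤ T.height c i x) → (x - A) ᵥ* UR ∈ Q := fun x hx => by
    rw [hQ, ← hφ]; exact ⟨x, hx, rfl⟩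
  have hQ' : ∀ y ∈ Q, ∃ x, (∀ i, 0 ≤ T.height c i x) ∧ y = (x - A) ᵥ* UR := by
    intro y hy
    rw [hQ] at hy
    obtain ⟨x, hx, rfl⟩ := hy
    exact ⟨x, hx, hφ x⟩
  have hpair : ∀ x y : Fin d → ℝ, (x ᵥ* UR) ⬝ᵥ (WR *ᵥ y) = x ⬝ᵥ y := fun x y => by
    rw [dotProduct_mulVec, vecMul_vecMul, hUW, vecMul_one]
  have hheight : ∀ i x, T.height c i x =
      (x - A) ⬝ᵥ latticePoint (T.normal i) + T.height c i A := fun i x => by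
    rw [dotProduct_comm, ← add_comm, ← T.height_add, add_sub_cancel]
  have h0 : (0 : Fin d → ℝ) ∈ interior Q := by
    have : (0 : Fin d → ℝ) ∈ interior Q ∩ Set.range (latticePoint (d := d)) := by
      rw [hint]; rfl
    exact this.1
  have hpos : ∀ i, 0 < T.height c i A := by
    intro i
    have := pos_of_mem_interior (r := WR *ᵥ latticePoint (T.normal i)) (β := T.height c i A)
      (Q := Q) (y := 0) ?_ ?_ h0
    · simpa using this
    · intro h
      have h' := congrArg (UR *ᵥ ·) h
      simp only [mulVec_mulVec, hUW, one_mulVec, mulVec_zero] at h'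
      apply T.normal_ne_zero i
      ext m
      have := congrFun h' m
      simpa [latticePoint] using this
    · intro y hy
      obtain ⟨x, hx, rfl⟩ := hQ' y hy
      rw [dotProduct_comm, hpair, ← hheight]
      exact hx i
  refine ⟨a, fun i => ?_⟩
  set H := T.height c i A with hH
  have hHpos : 0 < H := hpos i
  -- `n` is the vertex of the dual that corresponds to the `i`-th facet.
  set n : Fin d → ℝ := WR *ᵥ (-H⁻¹ • latticePoint (T.normal i)) with hn
  have hpn : ∀ x, ((x - A) ᵥ* UR) ⬝ᵥ n = 1 - H⁻¹ * T.height c i x := fun x => by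
    rw [hn, hpair, dotProduct_smul, hheight i x, smul_eq_mul]
    have := inv_mul_cancel₀ hHpos.ne'
    linear_combination this
  have hnV : n ∈ convexHull ℝ (latticePoint '' (V : Set (Fin d → ℤ))) := by
    rw [← hV]
    intro y hy
    obtain ⟨x, hx, rfl⟩ := hQ' y hy
    rw [hpn]
    have := mul_nonneg (inv_nonneg.2 hHpos.le) (hx i)
    linarith
  set u : ι → Fin d → ℝ := fun j => (c : ℝ) • latticePoint (T.vertex j) with hu
  have huQ : ∀ j, (u j - A) ᵥ* UR ∈ Q := fun j =>
    hmem _ fun i => T.height_smul_vertex_nonneg hc'.le i j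
  have hun : ∀ j, j ≠ i → ((u j - A) ᵥ* UR) ⬝ᵥ n = 1 := fun j hj => by
    rw [hpn, hu, height_smul, height_one_vertex, if_neg hj.symm]; simp
  -- Some lattice point of the dual does at least as well as `n` on the sum of the vertices of the
  -- `i`-th facet, hence lies on the same dual face as `n`.
  obtain ⟨_, ⟨v, hvV, rfl⟩, hv⟩ :=
    ((LinearMap.convexOn (dotProductBilin ℝ ℝ
      (∑ j ∈ Finset.univ.erase i, (u j - A) ᵥ* UR)) convex_univ).subset
        (Set.subset_univ _) (convex_convexHull ℝ _)).exists_ge_of_mem_convexHull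
      (subset_convexHull ℝ _) hnV
  have hv' : ∑ j ∈ Finset.univ.erase i, (1 : ℝ) ≤
      ∑ j ∈ Finset.univ.erase i, ((u j - A) ᵥ* UR) ⬝ᵥ latticePoint v := by
    rw [← Finset.sum_congr rfl fun j hj => hun j (Finset.ne_of_mem_erase hj), ← sum_dotProduct,
      ← sum_dotProduct]
    exact hv
  have hvd : latticePoint v ∈ dualPolytope Q := by
    rw [hV]; exact subset_convexHull ℝ _ ⟨v, hvV, rfl⟩
  have huv : ∀ j, j ≠ i → ((u j - A) ᵥ* UR) ⬝ᵥ latticePoint v = 1 := by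
    have hle : ∀ j ∈ Finset.univ.erase i, ((u j - A) ᵥ* UR) ⬝ᵥ latticePoint v ≤ 1 :=
      fun j _ => hvd _ (huQ j)
    intro j hj
    exact (Finset.sum_eq_sum_iff_of_le hle).1 (le_antisymm (Finset.sum_le_sum hle) hv') j
      (Finset.mem_erase.2 ⟨hj, Finset.mem_univ j⟩)
  -- The affine function `x ↦ 1 - ⟨x - a, z⟩` has integral linear part, vanishes on the `i`-th
  -- facet and is `1` at `a`; so `T.normal i` is `H` times an integral vector.
  set z : Fin d → ℤ := U *ᵥ v with hz
  set r : Fin d → ℝ := -latticePoint z with hr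
  have hval : ∀ x, (1 - r ⬝ᵥ A) + r ⬝ᵥ x = 1 - ((x - A) ᵥ* UR) ⬝ᵥ latticePoint v := fun x => by
    rw [← dotProduct_mulVec, hr, hz, latticePoint_mulVec, dotProduct_comm (x - A),
      dotProduct_sub, neg_dotProduct, neg_dotProduct]
    ring
  set μ : ℝ := ((1 - r ⬝ᵥ A) + r ⬝ᵥ u i) / (c * T.width i) with hμ
  have hvan : ∀ j, j ≠ i → (1 - r ⬝ᵥ A) + r ⬝ᵥ (c : ℝ) • latticePoint (T.vertex j) = 0 :=
    fun j hj => (hval _).trans (by rw [huv j hj, sub_self])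
  have hμH : μ * H = 1 := by
    have h := T.affine_eq_sum_height hc'.ne' (1 - r ⬝ᵥ A) r A
    rw [sub_add_cancel, Finset.sum_eq_single_of_mem i (Finset.mem_univ i)
      (fun j _ hj => by rw [hvan j hj]; simp)] at h
    exact h.symm
  have hrμ : ∀ m, r m = μ * T.normal i m := fun m => by
    have h := T.linear_eq_sum_normal hc'.ne' (1 - r ⬝ᵥ A) r m
    rwa [Finset.sum_eq_single_of_mem i (Finset.mem_univ i)
      (fun j _ hj => by rw [hvan j hj]; simp)] at h
  rw [hH, hA, T.height_latticePoint c i a] at hμH hHpos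
  refine (Int.isUnit_iff.1 (T.primitive i _ fun m => ⟨-z m, ?_⟩)).resolve_right ?_
  · have h := hrμ m
    simp only [hr, Pi.neg_apply, latticePoint] at h
    have : ((T.normal i m : ℤ) : ℝ) =
        (((T.normal i ⬝ᵥ a + c * T.const i) * -z m : ℤ) : ℝ) := by
      rw [Int.cast_mul, Int.cast_neg, h, ← mul_assoc]
      rw [mul_comm _ μ, hμH, one_mul]
    exact_mod_cast this
  · have := Int.cast_pos.1 hHpos
    omega

/-- If `a` has height one above every facet of the dilate, then translating `a` to the origin gives a
reflexive polytope, whose dual is the convex hull of the negated facet normals. -/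
theorem isGorenstein_of_height_eq_one {c : ℕ} (hc : 0 < c) {a : Fin d → ℤ}
    (ha : ∀ i, T.normal i ⬝ᵥ a + c * T.const i = 1) : IsGorenstein c T.carrier := by
  have hc' : (0 : ℝ) < c := Nat.cast_pos.2 hc
  set A : Fin d → ℝ := latticePoint a with hA
  have hone : ∀ i, T.height c i A = 1 := fun i => by
    rw [hA, height_latticePoint, ha, Int.cast_one]
  set Q : Set (Fin d → ℝ) := (fun x => x + latticePoint (-a)) '' dilate c T.carrier with hQ
  have hQmem : ∀ y, y ∈ Q ↔ ∀ i, 0 ≤ latticePoint (T.normal i) ⬝ᵥ y + 1 := by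
    intro y
    have key : ∀ i, T.height c i (y + A) = latticePoint (T.normal i) ⬝ᵥ y + 1 := fun i => by
      rw [add_comm y, height_add, hone, add_comm]
    rw [hQ, T.dilate_carrier hc]
    constructor
    · rintro ⟨x, hx, rfl⟩ i
      rw [← key]
      simpa [latticePoint_neg, hA] using hx i
    · intro h
      exact ⟨y + A, fun i => by rw [key]; exact h i, by simp [latticePoint_neg, hA]⟩
  have hrn : ∀ i, latticePoint (T.normal i) ≠ 0 := fun i h => T.normal_ne_zero i <| by
    ext m
    simpa [latticePoint] using congrFun h m
  refine ⟨T.isLatticePolytope_carrier, hc, Q, ⟨⟨?_, ?_⟩, ?_⟩, 1, -a, Or.inl det_one, ?_⟩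
  · refine isLatticePolytope_of_image (fun i => (c : ℤ) • T.vertex i + -a) ?_
    rw [hQ, T.dilate_carrier hc, T.setOf_height_nonneg_eq_convexHull hc']
    have := (AffineMap.image_convexHull
      ((AffineEquiv.vaddConst ℝ (latticePoint (-a))).toAffineMap)
      (Set.range fun i => (c : ℝ) • latticePoint (T.vertex i)))
    refine Eq.trans this ?_
    rw [← Set.range_comp]
    congr 2
    ext i m
    simp [latticePoint]
  · apply Set.Subset.antisymm
    · rintro _ ⟨hx, y, rfl⟩
      -- The heights of an interior lattice point are The heights of an interior lattice point are positive integers, so its products with the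
      -- normals are nonnegative; a positive combination of them vanishes, so each is zero.
      have hnn : ∀ i, 0 ≤ latticePoint (T.normal i) ⬝ᵥ latticePoint y := by
        intro i
        have h := pos_of_mem_interior (hrn i) (fun y hy => (hQmem y).1 hy i) hx
        rw [latticePoint_dotProduct] at h ⊢
        have h' : 0 < T.normal i ⬝ᵥ y + 1 := by exact_mod_cast h
        exact_mod_cast (by omega : 0 ≤ T.normal i ⬝ᵥ y)
      have hz := T.sum_height 0 (latticePoint y)
      simp only [zero_mul, add_zero] at hz
      rw [Finset.sum_eq_zero_iff_of_nonneg
        fun i _ => div_nonneg (hnn i) (T.width_pos_real i).le] at hz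
      have h := T.sum_height_smul_vertex 0 (latticePoint y)
      simp only [zero_mul, add_zero] at h
      rw [Finset.sum_eq_zero fun i hi => by rw [hz i hi, zero_smul]] at h
      exact h.symm
    · rintro _ rfl
      refine ⟨?_, 0, latticePoint_zero⟩
      refine interior_maximal (t := {y | ∀ i, 0 < latticePoint (T.normal i) ⬝ᵥ y + 1})
        (fun y hy => (hQmem y).2 fun i => (hy i).le) ?_ (by simp)
      rw [Set.ofPred_forall]
      refine isOpen_iInter_of_finite fun i => isOpen_lt continuous_const ?_
      unfold dotProduct
      fun_prop
  · refine isLatticePolytope_of_image (fun i => -T.normal i) (Set.Subset.antisymm ?_ ?_)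
    · intro y hy
      have hval : ∀ x, (1 + A ⬝ᵥ y) + (-y) ⬝ᵥ x = 1 - (x - A) ⬝ᵥ y := fun x => by
        rw [sub_dotProduct, neg_dotProduct, dotProduct_comm y]; ring
      set μ : ι → ℝ := fun j => ((1 + A ⬝ᵥ y) + (-y) ⬝ᵥ ((c : ℝ) • latticePoint (T.vertex j))) /
        (c * T.width j) with hμ
      have hμ0 : ∀ j, 0 ≤ μ j := fun j => by
        refine div_nonneg ?_ (mul_nonneg hc'.le (T.width_pos_real j).le)
        rw [hval, sub_nonneg]
        refine hy _ ((hQmem _).2 fun i => ?_)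
        have h := T.height_smul_vertex_nonneg hc'.le i j
        rw [← add_sub_cancel A (_ • _), height_add, hone] at h
        linarith
      have hμ1 : ∑ j, μ j = 1 := by
        have h := T.affine_eq_sum_height hc'.ne' (1 + A ⬝ᵥ y) (-y) A
        simp only [hone, mul_one] at h
        rw [hval, sub_self, zero_dotProduct, sub_zero] at h
        exact h.symm
      have hy' : ∑ j, μ j • latticePoint (-T.normal j) = y := by
        ext m
        have h := T.linear_eq_sum_normal hc'.ne' (1 + A ⬝ᵥ y) (-y) m
        rw [Pi.neg_apply] at h
        rw [← neg_neg (y m), h]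
        simp [latticePoint, hμ]
      rw [← hy']
      exact (convex_convexHull ℝ _).sum_mem (fun i _ => hμ0 i) hμ1
        (fun i _ => subset_convexHull ℝ _ ⟨i, rfl⟩)
    · refine convexHull_min ?_ ?_
      · rintro _ ⟨i, rfl⟩ x hx
        have := (hQmem x).1 hx i
        change x ⬝ᵥ latticePoint (-T.normal i) ≤ 1
        rw [latticePoint_neg, dotProduct_neg, dotProduct_comm]
        linarith
      · intro y hy z hz α β hα hβ hαβ x hx
        rw [dotProduct_add, dotProduct_smul, dotProduct_smul, smul_eq_mul, smul_eq_mul, ← hαβ]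
        exact add_le_add (mul_le_of_le_one_right hα (hy x hx))
          (mul_le_of_le_one_right hβ (hz x hx))
  · rw [hQ]
    congr 1
    ext x : 1
    simp [Matrix.map_one]

theorem isGorenstein_iff {c : ℕ} : IsGorenstein c T.carrier ↔
    0 < c ∧ ∃ a : Fin d → ℤ, ∀ i, T.normal i ⬝ᵥ a + c * T.const i = 1 :=
  ⟨fun h => ⟨h.2.1, T.exists_height_eq_one_of_isGorenstein h⟩,
    fun ⟨hc, _, ha⟩ => T.isGorenstein_of_height_eq_one hc ha⟩

end LatticeSimplex

/-! ### Lecture hall polytopes as lattice simplices -/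

variable {d e : ℕ}

/-- The sequence `1, s₁, …, s_d, 1, 1, …`, so that the facets of the lecture hall polytope are
indexed uniformly by pairs of consecutive terms. -/
def paddedSeq (s : Fin d → ℕ) (n : ℕ) : ℕ :=
  if h : 1 ≤ n ∧ n ≤ d then s ⟨n - 1, by omega⟩ else 1

/-- The sequence `0, x₁, …, x_d, c, c, …`. For `x` in the `c`-fold dilate, its ratios to the padded
sequence `s` are weakly increasing. -/
def paddedPoint {R : Type} [Zero R] (c : R) (x : Fin d → R) (n : ℕ) : R :=
  if n = 0 then 0 else if h : 1 ≤ n ∧ n ≤ d then x ⟨n - 1, by omega⟩ else c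

theorem paddedSeq_pos {s : Fin d → ℕ} (hs : ∀ i, 0 < s i) (n : ℕ) : 0 < paddedSeq s n := by
  unfold paddedSeq
  split_ifs
  · exact hs _
  · exact one_pos

theorem paddedSeq_zero (s : Fin d → ℕ) : paddedSeq s 0 = 1 := by simp [paddedSeq]

theorem paddedSeq_of_lt (s : Fin d → ℕ) {n : ℕ} (hn : d < n) : paddedSeq s n = 1 :=
  dif_neg (by omega)

theorem paddedSeq_succ (s : Fin d → ℕ) (m : Fin d) : paddedSeq s (m + 1) = s m := by
  rw [paddedSeq, dif_pos ⟨by omega, by omega⟩]; rfl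

theorem paddedPoint_zero {R : Type} [Zero R] (c : R) (x : Fin d → R) : paddedPoint c x 0 = 0 :=
  if_pos rfl

theorem paddedPoint_of_lt {R : Type} [Zero R] (c : R) (x : Fin d → R) {n : ℕ} (hn : d < n) :
    paddedPoint c x n = c := by
  rw [paddedPoint, if_neg (by omega), dif_neg (by omega)]

theorem paddedPoint_succ {R : Type} [Zero R] (c : R) (x : Fin d → R) (m : Fin d) :
    paddedPoint c x (m + 1) = x m := by
  rw [paddedPoint, if_neg (by omega), dif_pos ⟨by omega, by omega⟩]; rfl

/-- The greatest common divisor of two consecutive terms of the padded sequence. -/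
def stepGcd (s : Fin d → ℕ) (i : ℕ) : ℕ := Nat.gcd (paddedSeq s i) (paddedSeq s (i + 1))

theorem stepGcd_pos {s : Fin d → ℕ} (hs : ∀ i, 0 < s i) (i : ℕ) : 0 < stepGcd s i :=
  Nat.gcd_pos_of_pos_left _ (paddedSeq_pos hs i)

/-- The primitive inner normal `(S_i e_{i+1} - S_{i+1} e_i) / gcd(S_i, S_{i+1})` of the `i`-th
facet, where `S` is the padded sequence and `e_0 = e_{d+1} = 0`. -/
def facetNormal (s : Fin d → ℕ) (i : Fin (d + 1)) (m : Fin d) : ℤ :=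
  (if (m : ℕ) = i then ((paddedSeq s i / stepGcd s i : ℕ) : ℤ) else 0) -
    if (m : ℕ) + 1 = i then ((paddedSeq s (i + 1) / stepGcd s i : ℕ) : ℤ) else 0

/-- The constant term of the `i`-th facet inequality. -/
def facetConst (s : Fin d → ℕ) (i : Fin (d + 1)) : ℤ :=
  if (i : ℕ) = d then ((paddedSeq s i / stepGcd s i : ℕ) : ℤ) else 0

theorem sum_ite_val_eq {R : Type} [CommRing R] (α c : R) (x : Fin d → R) (i : Fin (d + 1)) :
    (∑ m : Fin d, (if (m : ℕ) = i then α else 0) * x m) + c * (if (i : ℕ) = d then α else 0) =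
      α * paddedPoint c x (i + 1) := by
  by_cases h : (i : ℕ) = d
  · rw [Finset.sum_eq_zero fun m _ => by rw [if_neg (by omega), zero_mul], if_pos h,
      paddedPoint_of_lt _ _ (by omega), zero_add, mul_comm]
  · have hi : (i : ℕ) < d := by omega
    rw [if_neg h, Finset.sum_eq_single_of_mem ⟨i, hi⟩ (Finset.mem_univ _) fun m _ hm => by
      rw [if_neg (fun h => hm (Fin.ext h)), zero_mul], if_pos rfl,
      ← paddedPoint_succ c x ⟨i, hi⟩, mul_zero, add_zero]

theorem sum_ite_val_succ_eq {R : Type} [CommRing R] (α c : R) (x : Fin d → R) (i : Fin (d + 1)) :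
    (∑ m : Fin d, (if (m : ℕ) + 1 = i then α else 0) * x m) = α * paddedPoint c x i := by
  by_cases h : (i : ℕ) = 0
  · rw [Finset.sum_eq_zero fun m _ => by rw [if_neg (by omega), zero_mul], h, paddedPoint_zero,
      mul_zero]
  · have hi : (i : ℕ) - 1 < d := by omega
    rw [Finset.sum_eq_single_of_mem ⟨i - 1, hi⟩ (Finset.mem_univ _) fun m _ hm => by
      rw [if_neg (fun h => hm (Fin.ext (by simp only; omega))), zero_mul],
      if_pos (by simp only; omega), ← paddedPoint_succ c x ⟨i - 1, hi⟩]
    simp only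
    rw [Nat.sub_add_cancel (by omega)]

/-- The `i`-th facet inequality of the `c`-fold dilate, in padded coordinates. -/
theorem facetNormal_dotProduct_add (R : Type) [CommRing R] (s : Fin d → ℕ) (c : R)
    (x : Fin d → R) (i : Fin (d + 1)) :
    (fun m => (facetNormal s i m : R)) ⬝ᵥ x + c * (facetConst s i : R) =
      ((paddedSeq s i / stepGcd s i : ℕ) : R) * paddedPoint c x (i + 1) -
        ((paddedSeq s (i + 1) / stepGcd s i : ℕ) : R) * paddedPoint c x i := by
  rw [← sum_ite_val_eq, ← sum_ite_val_succ_eq _ c, add_sub_right_comm, ← Finset.sum_sub_distrib]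
  simp only [dotProduct, facetNormal, facetConst, Int.cast_sub, Int.cast_ite, Int.cast_natCast,
    Int.cast_zero, sub_mul]

/-- The lattice distance of the `i`-th vertex from the opposite facet. -/
def facetWidth (s : Fin d → ℕ) (i : ℕ) : ℕ := paddedSeq s i / stepGcd s i * paddedSeq s (i + 1)

theorem facetWidth_pos {s : Fin d → ℕ} (hs : ∀ i, 0 < s i) (i : ℕ) : 0 < facetWidth s i :=
  Nat.mul_pos (Nat.div_pos (Nat.gcd_le_left _ (paddedSeq_pos hs i)) (stepGcd_pos hs i))
    (paddedSeq_pos hs _)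

theorem facet_cross_mul (s : Fin d → ℕ) (i : ℕ) :
    paddedSeq s (i + 1) / stepGcd s i * paddedSeq s i =
      paddedSeq s i / stepGcd s i * paddedSeq s (i + 1) := by
  rw [stepGcd, Nat.div_mul_right_comm (Nat.gcd_dvd_right _ _),
    Nat.div_mul_right_comm (Nat.gcd_dvd_left _ _), Nat.mul_comm]

/-- Divided by its maximum on the simplex, the `i`-th facet height is a difference of consecutive
ratios, so the normalized heights telescope. -/
theorem facet_height_div_width {s : Fin d → ℕ} (hs : ∀ i, 0 < s i) (c : ℝ) (x : Fin d → ℝ)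
    (i : Fin (d + 1)) :
    (latticePoint (facetNormal s i) ⬝ᵥ x + c * facetConst s i) / (facetWidth s i : ℤ) =
      paddedPoint c x (i + 1) / paddedSeq s (i + 1) - paddedPoint c x i / paddedSeq s i := by
  have h := facetNormal_dotProduct_add ℝ s c x i
  have h0 : (paddedSeq s i : ℝ) ≠ 0 := Nat.cast_ne_zero.2 (paddedSeq_pos hs _).ne'
  have h1 : (paddedSeq s (i + 1) : ℝ) ≠ 0 := Nat.cast_ne_zero.2 (paddedSeq_pos hs _).ne'
  have hw : (facetWidth s i : ℝ) ≠ 0 := Nat.cast_ne_zero.2 (facetWidth_pos hs _).ne'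
  have hc := congrArg (Nat.cast : ℕ → ℝ) (facet_cross_mul s i)
  unfold facetWidth at hw ⊢
  rw [Int.cast_natCast]
  rw [Nat.cast_mul] at hw ⊢
  rw [Nat.cast_mul, Nat.cast_mul] at hc
  unfold latticePoint
  rw [h, div_sub_div _ _ h1 h0, div_eq_div_iff hw (mul_ne_zero h1 h0)]
  linear_combination (-(paddedSeq s (i + 1) : ℝ) * paddedPoint c x i) * hc

/-- The vertex `(0, …, 0, s_{j+1}, …, s_d)`. -/
def hallVertex (s : Fin d → ℕ) (j : Fin (d + 1)) (m : Fin d) : ℤ := if (j : ℕ) ≤ m then s m else 0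

theorem paddedPoint_hallVertex (s : Fin d → ℕ) (j : Fin (d + 1)) (n : ℕ) :
    paddedPoint 1 (hallVertex s j) n = if (j : ℕ) < n then (paddedSeq s n : ℤ) else 0 := by
  rcases Nat.eq_zero_or_pos n with rfl | hn
  · simp [paddedPoint_zero]
  by_cases hd : n ≤ d
  · obtain ⟨m, rfl⟩ : ∃ m : Fin d, n = m + 1 := ⟨⟨n - 1, by omega⟩, by simp only; omega⟩
    rw [paddedPoint_succ, paddedSeq_succ, hallVertex]
    simp only [Nat.lt_succ_iff]
  · rw [paddedPoint_of_lt _ _ (by omega), paddedSeq_of_lt _ (by omega), if_pos (by omega)]; rfl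

/-- The lecture hall polytope as a lattice simplex. -/
def hallSimplex (hd : 1 ≤ d) {s : Fin d → ℕ} (hs : ∀ i, 0 < s i) :
    LatticeSimplex d (Fin (d + 1)) where
  vertex := hallVertex s
  normal := facetNormal s
  const := facetConst s
  width i := facetWidth s i
  width_pos i := Int.natCast_pos.2 (facetWidth_pos hs i)
  height_vertex i j := by
    have h := facetNormal_dotProduct_add ℤ s 1 (hallVertex s j) i
    simp only [Int.cast_id, one_mul, paddedPoint_hallVertex] at h
    refine h.trans ?_
    have hc := congrArg (Nat.cast : ℕ → ℤ) (facet_cross_mul s i)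
    rw [Nat.cast_mul, Nat.cast_mul] at hc
    rcases lt_trichotomy (j : ℕ) i with hij | hij | hij
    · rw [if_pos (by omega), if_pos hij, if_neg (fun h => by omega), hc, sub_self]
    · rw [if_pos (by omega), if_neg (by omega), if_pos (Fin.ext hij.symm), facetWidth, mul_zero,
        sub_zero, Nat.cast_mul]
    · rw [if_neg (by omega), if_neg (by omega), if_neg (fun h => by omega), mul_zero, mul_zero,
        sub_zero]
  sum_height c x := by
    simp only [facet_height_div_width hs]
    rw [Fin.sum_univ_eq_sum_range (fun n => paddedPoint c x (n + 1) / (paddedSeq s (n + 1) : ℝ) -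
      paddedPoint c x n / paddedSeq s n), Finset.sum_range_sub
      (fun n => paddedPoint c x n / (paddedSeq s n : ℝ)), paddedPoint_zero,
      paddedPoint_of_lt _ _ (by omega), paddedSeq_of_lt _ (by omega)]
    simp
  sum_height_smul_vertex c x := by
    ext m
    simp only [facet_height_div_width hs, Finset.sum_apply, Pi.smul_apply, smul_eq_mul]
    have hv : ∀ j : Fin (d + 1), latticePoint (hallVertex s j) m =
        if (j : ℕ) ∈ Finset.range (m + 1) then (s m : ℝ) else 0 := fun j => by
      simp [latticePoint, hallVertex]
    simp only [hv, mul_ite, mul_zero]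
    rw [Fin.sum_univ_eq_sum_range (fun n => if n ∈ Finset.range (m + 1) then
      (paddedPoint c x (n + 1) / (paddedSeq s (n + 1) : ℝ) -
        paddedPoint c x n / paddedSeq s n) * s m else 0), ← Finset.sum_filter,
      Finset.filter_mem_eq_inter, Finset.inter_eq_right.2 (Finset.range_subset_range.2 (by omega)),
      ← Finset.sum_mul,
      Finset.sum_range_sub (fun n => paddedPoint c x n / (paddedSeq s n : ℝ)), paddedPoint_zero,
      paddedPoint_succ, paddedSeq_succ, zero_div, sub_zero,
      div_mul_cancel₀ _ (Nat.cast_ne_zero.2 (hs m).ne')]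
  primitive i m hm := by
    -- At either end of the chain one of the two neighbouring terms is `1`; in between, the two
    -- coordinates of the normal are coprime.
    have hl : (i : ℕ) < d → m ∣ ((paddedSeq s i / stepGcd s i : ℕ) : ℤ) := fun hi => by
      simpa [facetNormal] using hm ⟨i, hi⟩
    have hr : 0 < (i : ℕ) → m ∣ ((paddedSeq s (i + 1) / stepGcd s i : ℕ) : ℤ) := fun hi => by
      have := hm ⟨i - 1, by omega⟩
      rw [facetNormal, if_neg (by simp only; omega), if_pos (by simp only; omega), zero_sub,
        dvd_neg] at this
      exact this
    rcases Nat.eq_zero_or_pos (i : ℕ) with hi | hi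
    · have := hl (by omega)
      rw [stepGcd, hi, paddedSeq_zero] at this
      simpa [isUnit_iff_dvd_one] using this
    rcases Nat.lt_or_ge i d with hi' | hi'
    · refine Int.isUnit_iff_natAbs_eq.2 (Nat.eq_one_of_dvd_coprimes
        (Nat.coprime_div_gcd_div_gcd (stepGcd_pos hs i)) ?_ ?_)
      · exact Int.natCast_dvd_natCast.1 (Int.natAbs_dvd.2 (hl hi'))
      · exact Int.natCast_dvd_natCast.1 (Int.natAbs_dvd.2 (hr hi))
    · have := hr hi
      rw [stepGcd, paddedSeq_of_lt s (n := i + 1) (by omega)] at this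
      simpa [isUnit_iff_dvd_one] using this

theorem hallSimplex_carrier (hd : 1 ≤ d) {s : Fin d → ℕ} (hs : ∀ i, 0 < s i) :
    (hallSimplex hd hs).carrier = lectureHallPolytope s := by
  ext x
  have hstep : x ∈ (hallSimplex hd hs).carrier ↔ ∀ i : Fin (d + 1),
      paddedPoint 1 x i / (paddedSeq s i : ℝ) ≤ paddedPoint 1 x (i + 1) / paddedSeq s (i + 1) := by
    refine forall_congr' fun i => ?_
    refine Iff.trans ?_ sub_nonneg
    rw [← facet_height_div_width hs]
    change 0 ≤ (hallSimplex hd hs).height 1 i x ↔ 0 ≤ _ / ((hallSimplex hd hs).width i : ℝ)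
    have hw := (hallSimplex hd hs).width_pos_real i
    exact ⟨fun h => div_nonneg h hw.le, fun h => by
      have := (le_div_iff₀ hw).1 h
      rwa [zero_mul] at this⟩
  have hx : ∀ m : Fin d, paddedPoint 1 x (m + 1) / (paddedSeq s (m + 1) : ℝ) = x m / s m :=
    fun m => by rw [paddedPoint_succ, paddedSeq_succ]
  rw [hstep]
  constructor
  · intro h
    have hmono : Monotone fun n => paddedPoint 1 x n / (paddedSeq s n : ℝ) := by
      refine monotone_nat_of_le_succ fun n => ?_
      rcases Nat.lt_or_ge n (d + 1) with hn | hn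
      · exact h ⟨n, hn⟩
      · simp only [paddedPoint_of_lt 1 x (show d < n by omega),
          paddedPoint_of_lt 1 x (show d < n + 1 by omega),
          paddedSeq_of_lt s (show d < n by omega), paddedSeq_of_lt s (show d < n + 1 by omega)]
        exact le_rfl
    refine ⟨fun i => ?_, fun i j hij => ?_, fun i => ?_⟩
    · have := hmono (Nat.zero_le (i + 1))
      simpa only [hx, paddedPoint_zero, zero_div] using this
    · have := hmono (Nat.succ_le_succ (show (i : ℕ) ≤ j from hij))
      simpa only [hx, Nat.succ_eq_add_one] using this
    · have := hmono (show (i : ℕ) + 1 ≤ d + 1 by omega)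
      simpa only [hx, paddedPoint_of_lt 1 x (Nat.lt_succ_self d),
        paddedSeq_of_lt s (Nat.lt_succ_self d), Nat.cast_one, div_one] using this
  · rintro ⟨h0, hm, h1⟩ i
    rcases Nat.eq_zero_or_pos (i : ℕ) with hi | hi
    · rw [hi, paddedPoint_zero, zero_div]
      exact (h0 ⟨0, hd⟩).trans_eq (hx ⟨0, hd⟩).symm
    obtain ⟨m, hmi⟩ : ∃ m : Fin d, (i : ℕ) = m + 1 := ⟨⟨i - 1, by omega⟩, by simp only; omega⟩
    rw [hmi, hx]
    rcases Nat.lt_or_ge (m + 1) d with hi' | hi'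
    · exact (hm (show m ≤ ⟨m + 1, hi'⟩ from Nat.le_succ m)).trans_eq (hx ⟨m + 1, hi'⟩).symm
    · rw [paddedPoint_of_lt _ _ (by omega), paddedSeq_of_lt _ (by omega)]
      simpa using h1 m

/-- The lecture hall polytope of `s` is Gorenstein of index `c` if and only if some integer sequence
`A` from `A 0 = 0` to `A (d + 1) = c` has cross differences with the padded sequence `S` equal to
the gcds of consecutive terms of `S`. Only the values of `A` up to `d + 1` matter. -/
theorem isGorenstein_lectureHallPolytope_iff (hd : 1 ≤ d) {s : Fin d → ℕ} (hs : ∀ i, 0 < s i)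
    (c : ℕ) : IsGorenstein c (lectureHallPolytope s) ↔
      0 < c ∧ ∃ A : ℕ → ℤ, A 0 = 0 ∧ A (d + 1) = c ∧ ∀ i ≤ d,
        paddedSeq s i * A (i + 1) - paddedSeq s (i + 1) * A i = stepGcd s i := by
  have hstep : ∀ (a : Fin d → ℤ) (i : Fin (d + 1)),
      facetNormal s i ⬝ᵥ a + c * facetConst s i = 1 ↔
        (paddedSeq s i : ℤ) * paddedPoint (c : ℤ) a (i + 1) -
          paddedSeq s (i + 1) * paddedPoint (c : ℤ) a i = stepGcd s i := by
    intro a i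
    have h := facetNormal_dotProduct_add ℤ s c a i
    simp only [Int.cast_id] at h
    have hg : (stepGcd s i : ℤ) ≠ 0 := Nat.cast_ne_zero.2 (stepGcd_pos hs i).ne'
    have h1 : (paddedSeq s i : ℤ) = stepGcd s i * (paddedSeq s i / stepGcd s i : ℕ) := by
      exact_mod_cast (Nat.mul_div_cancel' (Nat.gcd_dvd_left _ _)).symm
    have h2 : (paddedSeq s (i + 1) : ℤ) =
        stepGcd s i * (paddedSeq s (i + 1) / stepGcd s i : ℕ) := by
      exact_mod_cast (Nat.mul_div_cancel' (Nat.gcd_dvd_right _ _)).symm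
    refine (Eq.congr_left h).trans ?_
    conv_rhs => rw [h1, h2, mul_assoc, mul_assoc, ← mul_sub]
    exact (mul_eq_left₀ hg).symm
  rw [← hallSimplex_carrier hd hs, LatticeSimplex.isGorenstein_iff]
  refine and_congr_right fun _ => ⟨?_, ?_⟩
  · rintro ⟨a, ha⟩
    exact ⟨paddedPoint (c : ℤ) a, paddedPoint_zero _ _, paddedPoint_of_lt _ _ (Nat.lt_succ_self d),
      fun i hi => (hstep a ⟨i, by omega⟩).1 (ha ⟨i, by omega⟩)⟩
  · rintro ⟨A, hA0, hAd, hA⟩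
    have hpad : ∀ n ≤ d + 1, paddedPoint (c : ℤ) (fun m : Fin d => A (m + 1)) n = A n := by
      intro n hn
      rcases Nat.eq_zero_or_pos n with rfl | hn0
      · rw [paddedPoint_zero, hA0]
      rcases hn.lt_or_eq with hn' | rfl
      · obtain ⟨m, rfl⟩ : ∃ m : Fin d, n = m + 1 := ⟨⟨n - 1, by omega⟩, by simp only; omega⟩
        rw [paddedPoint_succ]
      · rw [paddedPoint_of_lt _ _ (Nat.lt_succ_self d), hAd]
    refine ⟨fun m => A (m + 1), fun i => (hstep _ i).2 ?_⟩
    rw [hpad _ (by omega), hpad _ (by omega)]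
    exact hA i (by omega)

/-! ### Concatenation -/

theorem paddedSeq_concatOne_of_le (s : Fin d → ℕ) (t : Fin e → ℕ) {n : ℕ} (hn : n ≤ d + 1) :
    paddedSeq (concatOne s t) n = paddedSeq s n := by
  rcases Nat.eq_zero_or_pos n with rfl | hn0
  · rw [paddedSeq_zero, paddedSeq_zero]
  obtain ⟨m, rfl⟩ : ∃ m, n = m + 1 := ⟨n - 1, by omega⟩
  rw [paddedSeq_succ _ (⟨m, by omega⟩ : Fin (d + e + 1))]
  rcases Nat.lt_or_ge m d with hm | hm
  · rw [paddedSeq_succ s ⟨m, hm⟩]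
    exact Fin.append_left s (Fin.cons 1 t : Fin (e + 1) → ℕ) ⟨m, hm⟩
  · obtain rfl : m = d := by omega
    rw [paddedSeq_of_lt s (Nat.lt_succ_self m)]
    exact Fin.append_right s (Fin.cons 1 t : Fin (e + 1) → ℕ) 0

theorem paddedSeq_concatOne_add (s : Fin d → ℕ) (t : Fin e → ℕ) (n : ℕ) :
    paddedSeq (concatOne s t) (d + 1 + n) = paddedSeq t n := by
  rcases Nat.eq_zero_or_pos n with rfl | hn0
  · rw [paddedSeq_zero, add_zero, paddedSeq_concatOne_of_le s t le_rfl,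
      paddedSeq_of_lt s (Nat.lt_succ_self d)]
  obtain ⟨m, rfl⟩ : ∃ m, n = m + 1 := ⟨n - 1, by omega⟩
  rcases Nat.lt_or_ge m e with hm | hm
  · rw [paddedSeq_succ t ⟨m, hm⟩, ← add_assoc,
      paddedSeq_succ (concatOne s t) ⟨d + 1 + m, by omega⟩]
    have h : (⟨d + 1 + m, by omega⟩ : Fin (d + (e + 1))) =
        Fin.natAdd d (Fin.succ ⟨m, hm⟩) := Fin.ext (by simp; omega)
    refine (congrArg (Fin.append s (Fin.cons 1 t : Fin (e + 1) → ℕ)) h).trans ?_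
    rw [Fin.append_right, Fin.cons_succ]
  · rw [paddedSeq_of_lt _ (by omega), paddedSeq_of_lt _ (by omega)]

theorem concatOne_pos {s : Fin d → ℕ} {t : Fin e → ℕ} (hs : ∀ i, 0 < s i) (ht : ∀ j, 0 < t j)
    (i : Fin (d + e + 1)) : 0 < concatOne s t i := by
  rw [← paddedSeq_succ (concatOne s t) i]
  rcases Nat.le_total ((i : ℕ) + 1) (d + 1) with h | h
  · rw [paddedSeq_concatOne_of_le s t h]
    exact paddedSeq_pos hs _
  · obtain ⟨n, hn⟩ := Nat.exists_eq_add_of_le h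
    rw [hn, paddedSeq_concatOne_add]
    exact paddedSeq_pos ht _

end LectureHall

theorem mainTheorem11 (d e : ℕ) (hd : 1 ≤ d) (he : 1 ≤ e)
    (s : Fin d → ℕ) (t : Fin e → ℕ) (hs : ∀ i, 0 < s i) (ht : ∀ j, 0 < t j) (k l : ℕ)
    (hk : LectureHall.IsGorenstein k (LectureHall.lectureHallPolytope s))
    (hl : LectureHall.IsGorenstein l (LectureHall.lectureHallPolytope t)) :
    LectureHall.IsGorenstein (k + l)
      (LectureHall.lectureHallPolytope (LectureHall.concatOne s t)) := by
  open LectureHall in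
  rw [isGorenstein_lectureHallPolytope_iff hd hs] at hk
  rw [isGorenstein_lectureHallPolytope_iff he ht] at hl
  obtain ⟨hk, A, hA0, hAd, hA⟩ := hk
  obtain ⟨hl, B, hB0, hBe, hB⟩ := hl
  rw [isGorenstein_lectureHallPolytope_iff (by omega) (concatOne_pos hs ht)]
  -- Adding a multiple of `t` does not change the cross differences, and `(A, B + k t)` agrees
  -- at the middle position `d + 1`.
  set C : ℕ → ℤ := fun n =>
    if n ≤ d + 1 then A n else B (n - (d + 1)) + k * paddedSeq t (n - (d + 1)) with hC
  have hCA : ∀ n ≤ d + 1, C n = A n := fun n hn => if_pos hn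
  have hCB : ∀ n, C (d + 1 + n) = B n + k * paddedSeq t n := by
    intro n
    rcases Nat.eq_zero_or_pos n with rfl | hn
    · rw [add_zero, hCA _ le_rfl, hAd, hB0, paddedSeq_zero]; simp
    · rw [hC]
      simp only
      rw [if_neg (by omega), Nat.add_sub_cancel_left]
  refine ⟨by omega, C, ?_, ?_, fun i hi => ?_⟩
  · rw [hCA 0 (by omega), hA0]
  · rw [show d + e + 1 + 1 = d + 1 + (e + 1) by omega, hCB, hBe,
      paddedSeq_of_lt t (Nat.lt_succ_self e)]
    push_cast; ring
  · rcases Nat.lt_or_ge i (d + 1) with h | h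
    · rw [stepGcd, paddedSeq_concatOne_of_le s t (by omega),
        paddedSeq_concatOne_of_le s t (by omega), hCA _ (by omega), hCA _ (by omega)]
      exact hA i (by omega)
    · obtain ⟨n, rfl⟩ := Nat.exists_eq_add_of_le h
      have := hB n (by omega)
      rw [stepGcd] at this ⊢
      rw [add_assoc (d + 1) n 1, paddedSeq_concatOne_add, paddedSeq_concatOne_add, hCB, hCB,
        ← this]
      ring
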